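/- Let $B \subset A$ be an inclusion of unital $C^*$-algebras and let $E : A \to B$ be a conditional expectation of finite Watatani index, i.e. there is a finite quasi-basis $u_1,\dots,u_n \in A$ with $x = \sum_i u_i E(u_i^* x)$ for all $x \in A$; then $1_A \in B$, and $\mathrm{Ind}_W(E) := \sum_i u_i u_i^*$ does not depend on the quasi-basis. Let $\mathrm{IMS}_W(B,A,E)$ be the set of intermediate $C^*$-subalgebras $B \subseteq C \subseteq A$ for which there is a conditional expectation $F : A \to C$ of finite Watatani index with $E|_C \circ F = E$; such an $F$ is unique. Regard $A$ as a Hilbert $B$-module with $\langle x, y\rangle_B = E(x^*y)$; let $A$ act on it by left multiplication, let $e_B$ and $e_C$ (for $C \in \mathrm{IMS}_W(B,A,E)$ with expectation $F$) be the Jones projections $x \mapsto E(x)$ and $x \mapsto F(x)$, let $A_1 = \mathrm{span}\{x e_B y : x,y\in A\}$ be the $C^*$-basic construction, and let $E_1 : A_1 \to A$ be the dual conditional expectation, $E_1(x e_B y) = \mathrm{Ind}_W(E)^{-1} x y$. With $\langle S, T\rangle_A = E_1(S^*T)$ and $\|T\|_{A_1} = \|E_1(T^*T)\|^{1/2}$,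 the interior angle $\alpha(C,D) \in [0,\pi/2]$ of $C, D \in \mathrm{IMS}_W(B,A,E)$ is defined by $$\cos \alpha(C,D) = \frac{\| \langle e_C - e_B,\, e_D - e_B\rangle_A \|}{\| e_C - e_B\|_{A_1}\, \|e_D - e_B\|_{A_1}}$$ (read as $0$ if $C = B$ or $D = B$, where the quotient is $0/0$). Let $P$ be a unital $C^*$-algebra, let $\otimes^{\min}$ denote the minimal (spatial) tensor product, constructed from any faithful unital representations of $A$ and $P$ on Hilbert spaces, and for a $C^*$-subalgebra $S \subseteq A$ regard $S \otimes^{\min} P$ as a $C^*$-subalgebra of $A \otimes^{\min} P$ in the natural way. Then: 1. The map $a \otimes p \mapsto E(a) \otimes p$ extends to a conditional expectation $E \otimes^{\min} \mathrm{id}_P : A \otimes^{\min} P \to B \otimes^{\min} P$; it has finite Watatani index, and $\mathrm{Ind}_W(E \otimes^{\min} \mathrm{id}_P) = \mathrm{Ind}_W(E) \otimes 1$. 2. If $C \in \mathrm{IMS}_W(B,A,E)$, then $C \otimes^{\min} P \in \mathrm{IMS}_W(B \otimes^{\min} P,\, A \otimes^{\min} P,\, E \otimes^{\min} \mathrm{id}_P)$.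 3. If $P \neq 0$ and $C, D \in \mathrm{IMS}_W(B,A,E)$, then $\alpha(C \otimes^{\min} P,\, D \otimes^{\min} P) = \alpha(C,D)$. -/

import Mathlib

open scoped TensorProduct

/-! ### Conditional expectations of finite Watatani index -/

namespace CStarIndex

variable {A : Type*} [CStarAlgebra A]

/-- `E` is a conditional expectation of the unital C*-algebra `A` onto its unital C*-subalgebra `B`:
a positive contractive `B`-bimodule projection of `A` onto `B`. (`E` is regarded as an idempotent
map `A → A` with range `B`.) -/
structure IsConditionalExpectation (B : StarSubalgebra ℂ A) (E : A →ₗ[ℂ] A) : Prop where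
  mem : ∀ x, E x ∈ B
  fix : ∀ b ∈ B, E b = b
  left_mul : ∀ b ∈ B, ∀ x, E (b * x) = b * E x
  right_mul : ∀ b ∈ B, ∀ x, E (x * b) = E x * b
  positive : ∀ x, ∃ y ∈ B, E (star x * x) = star y * y
  contractive : ∀ x, ‖E x‖ ≤ ‖x‖

/-- `u₁, …, uₙ` is a (right) quasi-basis for `E`: `x = ∑ uᵢ E(uᵢ* x)` for all `x`. -/
def IsQuasiBasis (E : A →ₗ[ℂ] A) {n : ℕ} (u : Fin n → A) : Prop :=
  ∀ x, x = ∑ i, u i * E (star (u i) * x)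

/-- `E` has finite Watatani index (unital case): it admits a finite quasi-basis. -/
def HasFiniteIndex (E : A →ₗ[ℂ] A) : Prop :=
  ∃ (n : ℕ) (u : Fin n → A), IsQuasiBasis E u

open Classical in
/-- The Watatani index `Ind_W(E) = ∑ uᵢ uᵢ*`, for any finite quasi-basis `u` of `E`; it does not
depend on `u`, see `watataniIndex_eq`. (The value is `0` if `E` has no finite quasi-basis.) -/
noncomputable def watataniIndex (E : A →ₗ[ℂ] A) : A :=
  if h : HasFiniteIndex E then
    ∑ i, h.choose_spec.choose i * star (h.choose_spec.choose i)
  else 0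

/-! ### Compatible intermediate subalgebras -/

/-- `C` is an intermediate C*-subalgebra `B ⊆ C ⊆ A`, and `F : A → C` is a conditional expectation
of finite Watatani index with `E|_C ∘ F = E`. -/
structure IsCompatible (B : StarSubalgebra ℂ A) (E : A →ₗ[ℂ] A) (C : StarSubalgebra ℂ A)
    (F : A →ₗ[ℂ] A) : Prop where
  le : B ≤ C
  isClosed : IsClosed (C : Set A)
  condExp : IsConditionalExpectation C F
  finiteIndex : HasFiniteIndex F
  comp_eq : E ∘ₗ F = E

/-- `IMS_W(B, A, E)`: the set of `E`-compatible intermediate C*-subalgebras of `B ⊆ A`. -/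
def IMS (B : StarSubalgebra ℂ A) (E : A →ₗ[ℂ] A) : Set (StarSubalgebra ℂ A) :=
  {C | ∃ F, IsCompatible B E C F}

/-! ### The C*-basic construction, the dual conditional expectation and the interior angle

For `E : A → B` of finite index, `A` is a Hilbert `B`-module for `⟨x, y⟩ = E(x* y)`. Operators on
this module are elements of `Module.End ℂ A`; the algebra `A` acts by left multiplication `λ`. -/

/-- `T` is the adjoint of `S` with respect to the `B`-valued inner product `⟨x, y⟩ = E(x* y)`. -/
def IsModuleAdjoint (E : A →ₗ[ℂ] A) (S T : Module.End ℂ A) : Prop :=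
  ∀ x y, E (star (S x) * y) = E (star x * T y)

open Classical in
/-- The adjoint `S*` of an adjointable operator `S` on the `B`-module `A` (unique as `E` is
faithful). -/
noncomputable def moduleAdjoint (E : A →ₗ[ℂ] A) (S : Module.End ℂ A) : Module.End ℂ A :=
  if h : ∃ T, IsModuleAdjoint E S T then h.choose else 0

/-- The Jones projection `e_E` of `E`: the operator `x ↦ E(x)` on `A`. -/
def jonesProj (E : A →ₗ[ℂ] A) : Module.End ℂ A := E

open Classical in
/-- The conditional expectation `F : A → C` making `C ∈ IMS_W(B, A, E)` compatible (it is
unique). -/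
noncomputable def compatibleExp (B : StarSubalgebra ℂ A) (E : A →ₗ[ℂ] A)
    (C : StarSubalgebra ℂ A) : A →ₗ[ℂ] A :=
  if h : ∃ F, IsCompatible B E C F then h.choose else 0

open Classical in
/-- The dual conditional expectation `E₁ : C*⟨A, e_E⟩ → A` of a conditional expectation `E` of
finite index. By `eq_sum_of_right_linear` the basic construction `C*⟨A, e_E⟩` is the linear span of
the operators `λ(x) e_E λ(y)` and contains all adjointable operators, and by
`dualExpectation_apply` the map `E₁` is determined by `E₁(λ(x) e_E λ(y)) = Ind_W(E)⁻¹ x y`. -/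
noncomputable def dualExpectation (E : A →ₗ[ℂ] A) : Module.End ℂ A →ₗ[ℂ] A :=
  if h : HasFiniteIndex E then
    LinearMap.mulLeft ℂ (Ring.inverse (watataniIndex E)) ∘ₗ
      ∑ i, LinearMap.mulRight ℂ (star (h.choose_spec.choose i)) ∘ₗ
        LinearMap.applyₗ (h.choose_spec.choose i)
  else 0

/-- The `A`-valued inner product `⟨S, T⟩_A = E₁(S* T)` on the basic construction. -/
noncomputable def basicInner (E : A →ₗ[ℂ] A) (S T : Module.End ℂ A) : A :=
  dualExpectation E (moduleAdjoint E S * T)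

/-- The Hilbert-module norm `‖T‖ = ‖E₁(T* T)‖^{1/2}` on the basic construction. -/
noncomputable def basicNorm (E : A →ₗ[ℂ] A) (T : Module.End ℂ A) : ℝ :=
  Real.sqrt ‖basicInner E T T‖

/-- The C*-interior angle `α(C, D) ∈ [0, π/2]` of `C, D ∈ IMS_W(B, A, E)`, given by
`cos α(C, D) = ‖⟨e_C - e_B, e_D - e_B⟩_A‖ / (‖e_C - e_B‖ ‖e_D - e_B‖)`. -/
noncomputable def interiorAngle (B : StarSubalgebra ℂ A) (E : A →ₗ[ℂ] A)
    (C D : StarSubalgebra ℂ A) : ℝ :=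
  Real.arccos
    (‖basicInner E (jonesProj (compatibleExp B E C) - jonesProj E)
        (jonesProj (compatibleExp B E D) - jonesProj E)‖ /
      (basicNorm E (jonesProj (compatibleExp B E C) - jonesProj E) *
        basicNorm E (jonesProj (compatibleExp B E D) - jonesProj E)))

/-! ### The definitions do not depend on the chosen quasi-basis -/

theorem IsConditionalExpectation.map_star {B : StarSubalgebra ℂ A} {E : A →ₗ[ℂ] A}
    (hE : IsConditionalExpectation B E) (x : A) : E (star x) = star (E x) := by
  have key : ∀ z, star (E (star z * z)) = E (star z * z) := by
    intro z
    obtain ⟨y, -, hy⟩ := hE.positive z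
    rw [hy, star_mul, star_star]
  have sum : ∀ z, star (E z) + star (E (star z)) = E z + E (star z) := by
    intro z
    have h1 := key (1 + z)
    have h2 := key z
    have h3 := key 1
    have e : star (1 + z) * (1 + z) = star 1 * 1 + z + star z + star z * z := by
      simp only [star_add, star_one]; noncomm_ring
    rw [e] at h1
    simp only [map_add, star_add, h2, h3] at h1
    have := add_right_cancel h1
    rw [add_assoc, add_assoc] at this
    exact add_left_cancel this
  have s1 := sum x
  have s2 := sum (Complex.I • x)
  simp only [star_smul, map_smul, Complex.star_def, Complex.conj_I, neg_smul, map_neg,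
    star_neg, neg_neg] at s2
  have s3 : Complex.I • (star (E (star x)) - star (E x)) = Complex.I • (E x - E (star x)) := by
    rw [smul_sub, smul_sub, sub_eq_neg_add, s2, ← sub_eq_add_neg]
  have s4 := smul_right_injective A Complex.I_ne_zero s3
  have s5 : (2 : ℂ) • E (star x) = (2 : ℂ) • star (E x) := by
    rw [two_smul, two_smul]
    have s4' : star (E (star x)) - star (E x) = E x - E (star x) := s4
    have d1 : E (star x) + E (star x) = (E x + E (star x)) - (E x - E (star x)) := by abel
    rw [d1, ← s1, ← s4']
    abel
  exact smul_right_injective A (two_ne_zero (α := ℂ)) s5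

theorem IsQuasiBasis.right {B : StarSubalgebra ℂ A} {E : A →ₗ[ℂ] A}
    (hE : IsConditionalExpectation B E) {n : ℕ} {u : Fin n → A} (hu : IsQuasiBasis E u) (x : A) :
    ∑ i, E (x * u i) * star (u i) = x := by
  have h := congrArg star (hu (star x))
  rw [star_star, star_sum] at h
  rw [h]
  refine Finset.sum_congr rfl fun i _ => ?_
  rw [star_mul, ← hE.map_star, star_mul, star_star, star_star, ← h]

theorem watataniIndex_eq {B : StarSubalgebra ℂ A} {E : A →ₗ[ℂ] A}
    (hE : IsConditionalExpectation B E) {n : ℕ} {u : Fin n → A} (hu : IsQuasiBasis E u) :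
    watataniIndex E = ∑ i, u i * star (u i) := by
  have h : HasFiniteIndex E := ⟨n, u, hu⟩
  rw [watataniIndex, dif_pos h]
  set v := h.choose_spec.choose with hv
  have hv' : IsQuasiBasis E v := h.choose_spec.choose_spec
  calc ∑ i, v i * star (v i)
      = ∑ i, v i * ∑ j, E (star (v i) * u j) * star (u j) := by
        simp only [hu.right hE]
    _ = ∑ j, (∑ i, v i * E (star (v i) * u j)) * star (u j) := by
        simp only [Finset.mul_sum, Finset.sum_mul, mul_assoc]
        exact Finset.sum_comm
    _ = ∑ j, u j * star (u j) := by
        refine Finset.sum_congr rfl fun j _ => ?_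
        rw [← hv' (u j)]

/-- Every right `B`-linear operator on `A` is a finite sum of operators `λ(x) e_E λ(y)`. -/
theorem eq_sum_of_right_linear {B : StarSubalgebra ℂ A} {E : A →ₗ[ℂ] A}
    (hE : IsConditionalExpectation B E) {n : ℕ} {u : Fin n → A} (hu : IsQuasiBasis E u)
    (T : Module.End ℂ A) (hT : ∀ x, ∀ b ∈ B, T (x * b) = T x * b) :
    T = ∑ i, LinearMap.mulLeft ℂ (T (u i)) * jonesProj E * LinearMap.mulLeft ℂ (star (u i)) := by
  ext x
  conv_lhs => rw [hu x]
  simp [jonesProj, hT _ _ (hE.mem _)]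

/-- `E₁(λ(x) e_E λ(y)) = Ind_W(E)⁻¹ x y`. -/
theorem dualExpectation_apply {B : StarSubalgebra ℂ A} {E : A →ₗ[ℂ] A}
    (hE : IsConditionalExpectation B E) (hfin : HasFiniteIndex E) (x y : A) :
    dualExpectation E (LinearMap.mulLeft ℂ x * jonesProj E * LinearMap.mulLeft ℂ y) =
      Ring.inverse (watataniIndex E) * (x * y) := by
  have hv : IsQuasiBasis E hfin.choose_spec.choose := hfin.choose_spec.choose_spec
  rw [dualExpectation, dif_pos hfin]
  simp only [LinearMap.comp_apply, LinearMap.mulLeft_apply, LinearMap.sum_apply,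
    LinearMap.mulRight_apply, LinearMap.applyₗ_apply_apply, Module.End.mul_apply, jonesProj]
  congr 1
  conv_rhs => rw [← hv.right hE y]
  simp only [Finset.mul_sum, mul_assoc]

end CStarIndex

/-! ### The minimal (spatial) tensor product -/

namespace MinimalTensor

open CStarIndex

variable {A P H K : Type*} [CStarAlgebra A] [CStarAlgebra P]
  [NormedAddCommGroup H] [InnerProductSpace ℂ H] [CompleteSpace H]
  [NormedAddCommGroup K] [InnerProductSpace ℂ K] [CompleteSpace K]

/-- The Hilbert space tensor product of `H` and `K`: the completion of the algebraic tensor product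
for the inner product `⟨h ⊗ k, h' ⊗ k'⟩ = ⟨h, h'⟩ ⟨k, k'⟩`. -/
def HilbertTensor (H K : Type*) [NormedAddCommGroup H] [InnerProductSpace ℂ H]
    [NormedAddCommGroup K] [InnerProductSpace ℂ K] : Type _ :=
  UniformSpace.Completion (H ⊗[ℂ] K)

noncomputable instance : NormedAddCommGroup (HilbertTensor H K) :=
  inferInstanceAs (NormedAddCommGroup (UniformSpace.Completion (H ⊗[ℂ] K)))

noncomputable instance : InnerProductSpace ℂ (HilbertTensor H K) :=
  inferInstanceAs (InnerProductSpace ℂ (UniformSpace.Completion (H ⊗[ℂ] K)))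

instance : CompleteSpace (HilbertTensor H K) :=
  inferInstanceAs (CompleteSpace (UniformSpace.Completion (H ⊗[ℂ] K)))

/-- The operator `S ⊗ T` on the Hilbert space tensor product. -/
noncomputable def opTensor (S : H →L[ℂ] H) (T : K →L[ℂ] K) :
    HilbertTensor H K →L[ℂ] HilbertTensor H K :=
  (TensorProduct.mapL S T).completion

/-- For faithful representations `π` of `A` on `H` and `ρ` of `P` on `K`, the minimal tensor product
`A ⊗^min P`: the closed *-subalgebra of `B(H ⊗ K)` generated by the operators `π(a) ⊗ ρ(p)`. -/
noncomputable def spatialTensor (π : A →⋆ₐ[ℂ] (H →L[ℂ] H)) (ρ : P →⋆ₐ[ℂ] (K →L[ℂ] K)) :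
    StarSubalgebra ℂ (HilbertTensor H K →L[ℂ] HilbertTensor H K) :=
  (StarAlgebra.adjoin ℂ {x | ∃ a p, x = opTensor (π a) (ρ p)}).topologicalClosure

/-- The minimal tensor product `A ⊗^min P` as a C*-algebra. -/
abbrev MinTensor (π : A →⋆ₐ[ℂ] (H →L[ℂ] H)) (ρ : P →⋆ₐ[ℂ] (K →L[ℂ] K)) : Type _ :=
  ↥(spatialTensor π ρ)

noncomputable instance (π : A →⋆ₐ[ℂ] (H →L[ℂ] H)) (ρ : P →⋆ₐ[ℂ] (K →L[ℂ] K)) :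
    CStarAlgebra (MinTensor π ρ) :=
  StarSubalgebra.cstarAlgebra _ (h_closed := StarSubalgebra.isClosed_topologicalClosure _)

/-- The elementary tensor `a ⊗ p` in `A ⊗^min P`. -/
noncomputable def tmul (π : A →⋆ₐ[ℂ] (H →L[ℂ] H)) (ρ : P →⋆ₐ[ℂ] (K →L[ℂ] K)) (a : A) (p : P) :
    MinTensor π ρ :=
  ⟨opTensor (π a) (ρ p),
    StarSubalgebra.le_topologicalClosure _ (StarAlgebra.subset_adjoin ℂ _ ⟨a, p, rfl⟩)⟩

/-- For a C*-subalgebra `S ⊆ A`, the minimal tensor product `S ⊗^min P` as a C*-subalgebra of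
`A ⊗^min P`: the closed *-subalgebra generated by the tensors `s ⊗ p` with `s ∈ S`, `p ∈ P`. -/
noncomputable def sub (π : A →⋆ₐ[ℂ] (H →L[ℂ] H)) (ρ : P →⋆ₐ[ℂ] (K →L[ℂ] K))
    (S : StarSubalgebra ℂ A) : StarSubalgebra ℂ (MinTensor π ρ) :=
  (StarAlgebra.adjoin ℂ {x | ∃ s ∈ S, ∃ p, x = tmul π ρ s p}).topologicalClosure

end MinimalTensor

/-!
The only analytic point is that `E ⊗ id` is bounded for the spatial norm. A conditional expectation
with a quasi-basis `u` satisfies `E(x* x) = ∑ E(uᵢ* x)* E(uᵢ* x)`, so it is positive for a purely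
algebraic reason, and the Schwarz inequality makes it contractive (`norm_le_of_isQuasiBasis`).
Applied entrywise to matrices it again has a quasi-basis, the diagonal matrices with entries `uᵢ`,
so `E` is completely contractive (`norm_mapₗ_le`). A vector of the algebraic tensor product `H ⊗ K`
has the form `∑ hᵢ ⊗ eᵢ` with `e` orthonormal, and the compression of `∑ π(aₖ) ⊗ ρ(pₖ)` to the
subspace `∑ H ⊗ eᵢ` is the image under the amplification of `π` of the matrix
`(∑ₖ ⟨eᵢ, ρ(pₖ) eⱼ⟩ aₖ)ᵢⱼ` over `A`, on which `E ⊗ id` acts entrywise. As the amplification of a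
faithful representation is isometric, this gives `norm_ofAlgTensor_rTensor_le`, and `E ⊗ id` extends
by continuity (`tensorId`).

The remaining algebraic identities pass from elementary tensors to the closure by density: the
elements `uᵢ ⊗ 1` form a quasi-basis of `E ⊗ id`, which gives positivity, contractivity, the index
and the compatibility of intermediate algebras. For the angle, a quasi-basis of `E` expresses
`⟨e_C - e_B, e_D - e_B⟩` as `Ind(E)⁻¹ ∑ (F - E)((G - E)(uᵢ)) uᵢ*`, so the inner product for
the tensored inclusion is the image of the original one under the embedding `a ↦ a ⊗ 1`
(`basicInner_tensorId`), which is isometric when `P ≠ 0`.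
-/

/-! ### Maps with a quasi-basis -/

namespace CStarIndex

section

variable {A : Type*} [CStarAlgebra A] {B : StarSubalgebra ℂ A} {E : A →ₗ[ℂ] A}
  {n : ℕ} {u : Fin n → A}

/-- A bimodule map with a quasi-basis is manifestly positive. -/
theorem map_star_mul_self_eq_sum (hstar : ∀ x, E (star x) = star (E x))
    (hr : ∀ x y, E (x * E y) = E x * E y) (hu : IsQuasiBasis E u) (x : A) :
    E (star x * x) = ∑ i, star (E (star (u i) * x)) * E (star (u i) * x) := by
  conv_lhs => rw [hu x, Finset.mul_sum, map_sum]
  rw [← hu x]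
  refine Finset.sum_congr rfl fun i _ => ?_
  rw [← mul_assoc, hr, ← hstar, star_mul, star_star]

theorem exists_sum_star_mul_self_eq (f : Fin n → A) :
    ∃ y, ∑ i, star (f i) * f i = star y * y := by
  let := CStarAlgebra.spectralOrder A
  have := CStarAlgebra.spectralOrderedRing A
  exact CStarAlgebra.nonneg_iff_eq_star_mul_self.mp
    (Finset.sum_nonneg fun i _ => star_mul_self_nonneg _)

section Contractive

attribute [local instance] CStarAlgebra.spectralOrder CStarAlgebra.spectralOrderedRing

/-- Contractivity follows from positivity by the Schwarz inequality `E(x)* E(x) ≤ E(x* x)`. -/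
theorem norm_le_of_isQuasiBasis (hone : E 1 = 1) (hstar : ∀ x, E (star x) = star (E x))
    (hr : ∀ x y, E (x * E y) = E x * E y) (hu : IsQuasiBasis E u) (x : A) : ‖E x‖ ≤ ‖x‖ := by
  have hpos : ∀ y, 0 ≤ E (star y * y) := fun y => by
    rw [map_star_mul_self_eq_sum hstar hr hu]
    exact Finset.sum_nonneg fun i _ => star_mul_self_nonneg _
  have hidem : ∀ y, E (E y) = E y := fun y => by simpa [hone] using hr 1 y
  have hl : ∀ y z, E (E y * z) = E y * E z := fun y z => by
    have := congrArg star (hr (star z) (star y))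
    simpa [← hstar] using this
  -- Schwarz: expand `0 ≤ E((x - E x)* (x - E x))`
  have schwarz : star (E x) * E x ≤ E (star x * x) := by
    have h := hpos (x - E x)
    have e : star (x - E x) * (x - E x)
        = star x * x - star x * E x - E (star x) * x + E (star x) * E x := by
      rw [hstar, star_sub]; noncomm_ring
    rw [e] at h
    simp only [map_add, map_sub, hr, hl, hidem] at h
    simp only [hstar] at h
    rw [← sub_nonneg]
    convert h using 1
    noncomm_ring
  have bound : E (star x * x) ≤ algebraMap ℝ A (‖x‖ ^ 2) := by
    -- `‖x‖² - x* x` has the form `y* y`, so `E` maps it to a positive element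
    have h1 : 0 ≤ algebraMap ℝ A (‖x‖ ^ 2) - star x * x := by
      rw [sub_nonneg, pow_two, ← CStarRing.norm_star_mul_self]
      exact IsSelfAdjoint.le_algebraMap_norm_self (.star_mul_self x)
    obtain ⟨y, hy⟩ := CStarAlgebra.nonneg_iff_eq_star_mul_self.mp h1
    have h2 := hpos y
    rw [← hy, map_sub, sub_nonneg, Algebra.algebraMap_eq_smul_one] at h2
    rwa [LinearMap.map_smul_of_tower, hone, ← Algebra.algebraMap_eq_smul_one] at h2
  have h := (CStarAlgebra.norm_le_iff_le_algebraMap _ (by positivity)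
    (star_mul_self_nonneg (E x))).mpr (schwarz.trans bound)
  rw [CStarRing.norm_star_mul_self, ← pow_two] at h
  exact le_of_sq_le_sq h (norm_nonneg _)

/-- A self-adjoint `B`-linear projection onto `B` with a quasi-basis is automatically positive and
contractive. -/
theorem isConditionalExpectation_of_isQuasiBasis (hB : IsClosed (B : Set A))
    (mem : ∀ x, E x ∈ B) (fix : ∀ b ∈ B, E b = b) (right_mul : ∀ b ∈ B, ∀ x, E (x * b) = E x * b)
    (hstar : ∀ x, E (star x) = star (E x)) (hu : IsQuasiBasis E u) :
    IsConditionalExpectation B E where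
  mem := mem
  fix := fix
  left_mul b hb x := by
    have := congrArg star (right_mul (star b) (star_mem hb) (star x))
    simpa [← hstar] using this
  right_mul := right_mul
  positive x := by
    -- the square root is taken in the C*-algebra `B`, so that the witness lies in `B`
    let : CStarAlgebra B := StarSubalgebra.cstarAlgebra B (h_closed := hB)
    obtain ⟨y, hy⟩ := exists_sum_star_mul_self_eq (A := B) fun i => ⟨E (star (u i) * x), mem _⟩
    refine ⟨y, y.2, ?_⟩
    rw [map_star_mul_self_eq_sum hstar (fun x y => right_mul _ (mem y) x) hu]
    simpa using congrArg (Subtype.val) hy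
  contractive := norm_le_of_isQuasiBasis (fix 1 (one_mem B)) hstar
    (fun x y => right_mul _ (mem y) x) hu

end Contractive

theorem IsConditionalExpectation.map_mul_map (hE : IsConditionalExpectation B E) (x y : A) :
    E (x * E y) = E x * E y :=
  hE.right_mul _ (hE.mem y) x

theorem IsConditionalExpectation.map_one (hE : IsConditionalExpectation B E) : E 1 = 1 :=
  hE.fix 1 (one_mem B)

/-- A conditional expectation of finite index is faithful. -/
theorem eq_zero_of_map_star_mul_self_eq_zero (hE : IsConditionalExpectation B E)
    (hfin : HasFiniteIndex E) {x : A} (hx : E (star x * x) = 0) : x = 0 := by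
  let := CStarAlgebra.spectralOrder A
  have := CStarAlgebra.spectralOrderedRing A
  obtain ⟨n, u, hu⟩ := hfin
  rw [map_star_mul_self_eq_sum hE.map_star hE.map_mul_map hu,
    Finset.sum_eq_zero_iff_of_nonneg fun i _ => star_mul_self_nonneg _] at hx
  rw [hu x]
  refine Finset.sum_eq_zero fun i hi => ?_
  rw [CStarRing.star_mul_self_eq_zero_iff _ |>.mp (hx i hi), mul_zero]

/-! ### Jones projections and the inner product of the basic construction -/

variable {C : StarSubalgebra ℂ A} {F : A →ₗ[ℂ] A}

theorem IsCompatible.map_map (h : IsCompatible B E C F) (x : A) : E (F x) = E x :=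
  LinearMap.congr_fun h.comp_eq x

/-- The expectation of a compatible intermediate algebra `C` is determined by
`E(c F(x)) = E(c x)` for `c ∈ C`, because `E` is faithful. -/
theorem IsCompatible.unique (hE : IsConditionalExpectation B E) (hfin : HasFiniteIndex E)
    {F' : A →ₗ[ℂ] A} (h : IsCompatible B E C F) (h' : IsCompatible B E C F') : F = F' := by
  ext x
  rw [← sub_eq_zero]
  have key : ∀ c ∈ C, E (c * (F x - F' x)) = 0 := fun c hc => by
    rw [mul_sub, map_sub, ← h.condExp.left_mul c hc, ← h'.condExp.left_mul c hc, h.map_map,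
      h'.map_map, sub_self]
  exact eq_zero_of_map_star_mul_self_eq_zero hE hfin
    (key _ (star_mem (sub_mem (h.condExp.mem x) (h'.condExp.mem x))))

theorem IsCompatible.compatibleExp_eq (hE : IsConditionalExpectation B E)
    (hfin : HasFiniteIndex E) (h : IsCompatible B E C F) : compatibleExp B E C = F := by
  have hex : ∃ F, IsCompatible B E C F := ⟨F, h⟩
  rw [compatibleExp, dif_pos hex]
  exact IsCompatible.unique hE hfin hex.choose_spec h

theorem moduleAdjoint_eq (hE : IsConditionalExpectation B E) (hfin : HasFiniteIndex E)
    {S T : Module.End ℂ A} (h : IsModuleAdjoint E S T) : moduleAdjoint E S = T := by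
  have hex : ∃ T, IsModuleAdjoint E S T := ⟨T, h⟩
  rw [moduleAdjoint, dif_pos hex]
  have h' := hex.choose_spec
  set T' := hex.choose
  ext y
  rw [← sub_eq_zero]
  refine eq_zero_of_map_star_mul_self_eq_zero hE hfin ?_
  rw [mul_sub, map_sub, ← h, ← h', sub_self]

/-- The operator `e_C - e_B` on the Hilbert module `A` is self-adjoint. -/
theorem IsCompatible.isModuleAdjoint (hE : IsConditionalExpectation B E)
    (h : IsCompatible B E C F) :
    IsModuleAdjoint E (jonesProj F - jonesProj E) (jonesProj F - jonesProj E) := by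
  intro x y
  have h1 : E (star (F x) * y) = E (star x * F y) := by
    rw [← h.map_map (star (F x) * y), h.condExp.left_mul _ (star_mem (h.condExp.mem x)),
      ← h.map_map (star x * F y), h.condExp.right_mul _ (h.condExp.mem y), h.condExp.map_star]
  have h2 : E (star (E x) * y) = E (star x * E y) := by
    rw [hE.left_mul _ (star_mem (hE.mem x)), hE.right_mul _ (hE.mem y), hE.map_star]
  simp only [jonesProj, LinearMap.sub_apply, star_sub, sub_mul, mul_sub, map_sub, h1, h2]

theorem dualExpectation_eq_of_right_linear (hE : IsConditionalExpectation B E)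
    (hu : IsQuasiBasis E u) (T : Module.End ℂ A) (hT : ∀ x, ∀ b ∈ B, T (x * b) = T x * b) :
    dualExpectation E T = Ring.inverse (watataniIndex E) * ∑ i, T (u i) * star (u i) := by
  conv_lhs => rw [eq_sum_of_right_linear hE hu T hT, map_sum]
  simp only [dualExpectation_apply hE ⟨n, u, hu⟩, Finset.mul_sum]

/-- The inner product `⟨e_C - e_B, e_D - e_B⟩` computed with an arbitrary quasi-basis. -/
theorem basicInner_compatible {D : StarSubalgebra ℂ A} {G : A →ₗ[ℂ] A}
    (hE : IsConditionalExpectation B E) (hu : IsQuasiBasis E u)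
    (hF : IsCompatible B E C F) (hG : IsCompatible B E D G) :
    basicInner E (jonesProj F - jonesProj E) (jonesProj G - jonesProj E) =
      Ring.inverse (watataniIndex E) * ∑ i, (F - E) ((G - E) (u i)) * star (u i) := by
  rw [basicInner, moduleAdjoint_eq hE ⟨n, u, hu⟩ (hF.isModuleAdjoint hE),
    dualExpectation_eq_of_right_linear hE hu]
  · rfl
  · intro x b hb
    simp only [jonesProj, Module.End.mul_apply, LinearMap.sub_apply,
      hE.right_mul b hb, hG.condExp.right_mul b (hG.le hb), hF.condExp.right_mul b (hF.le hb),
      ← sub_mul]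

end

/-! ### Complete contractivity -/

section Matrix

variable {A : Type*} [CStarAlgebra A] [PartialOrder A] [StarOrderedRing A]
  {B : StarSubalgebra ℂ A} {E : A →ₗ[ℂ] A}

/-- A conditional expectation of finite index is completely contractive: applied to every entry it
is again given by a quasi-basis, formed by the diagonal matrices. -/
theorem norm_mapₗ_le (hE : IsConditionalExpectation B E) (hfin : HasFiniteIndex E)
    {m : Type*} [Fintype m] [DecidableEq m] (X : CStarMatrix m m A) :
    ‖CStarMatrix.mapₗ E X‖ ≤ ‖X‖ := by
  obtain ⟨n, u, hu⟩ := hfin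
  refine norm_le_of_isQuasiBasis (A := CStarMatrix m m A) (E := CStarMatrix.mapₗ E)
    (u := fun k => CStarMatrix.ofMatrix (Matrix.diagonal fun _ => u k)) ?_ ?_ ?_ ?_ X
  · ext i j
    by_cases h : i = j <;> simp [CStarMatrix.mapₗ, CStarMatrix.one_apply, h, hE.map_one]
  · intro X
    ext i j
    simp [CStarMatrix.mapₗ, CStarMatrix.star_apply, hE.map_star]
  · intro X Y
    ext i j
    simp [CStarMatrix.mapₗ, CStarMatrix.mul_apply, hE.map_mul_map]
  · intro X
    ext i j
    refine (hu (X i j)).trans (Eq.trans ?_ (Matrix.sum_apply i j _ _).symm)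
    refine Finset.sum_congr rfl fun k _ => Eq.trans ?_ (Matrix.diagonal_mul _ _ _ _).symm
    simp [CStarMatrix.mapₗ, CStarMatrix.mul_apply, CStarMatrix.star_apply, Matrix.diagonal_apply,
      apply_ite star]

end Matrix

end CStarIndex

/-! ### Operators on the Hilbert space tensor product -/

namespace MinimalTensor

open CStarIndex

section Hilbert

variable {H K : Type*} [NormedAddCommGroup H] [InnerProductSpace ℂ H]
  [NormedAddCommGroup K] [InnerProductSpace ℂ K]

/-- The isometric inclusion of the algebraic tensor product into the Hilbert space tensor
product. -/
noncomputable def inclusion : H ⊗[ℂ] K →ₗᵢ[ℂ] HilbertTensor H K :=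
  (UniformSpace.Completion.toComplₗᵢ : H ⊗[ℂ] K →ₗᵢ[ℂ] UniformSpace.Completion (H ⊗[ℂ] K))

theorem denseRange_inclusion : DenseRange (inclusion : H ⊗[ℂ] K →ₗᵢ[ℂ] HilbertTensor H K) :=
  UniformSpace.Completion.denseRange_coe

theorem opTensor_inclusion (S : H →L[ℂ] H) (T : K →L[ℂ] K) (x : H ⊗[ℂ] K) :
    opTensor S T (inclusion x) = inclusion (TensorProduct.mapL S T x) :=
  ContinuousLinearMap.completion_apply_coe _ x

theorem opTensor_inclusion_tmul (S : H →L[ℂ] H) (T : K →L[ℂ] K) (h : H) (k : K) :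
    opTensor S T (inclusion (h ⊗ₜ k)) = inclusion (S h ⊗ₜ T k) :=
  opTensor_inclusion S T _

/-- Bounded operators on `H ⊗ K` are determined by their values on elementary tensors. -/
theorem operator_ext {S T : HilbertTensor H K →L[ℂ] HilbertTensor H K}
    (h : ∀ x y, S (inclusion (x ⊗ₜ y)) = T (inclusion (x ⊗ₜ y))) : S = T := by
  refine DFunLike.coe_injective (denseRange_inclusion.equalizer S.continuous T.continuous ?_)
  funext z
  induction z using TensorProduct.induction_on with
  | zero => simp
  | tmul x y => exact h x y
  | add z w hz hw => simp_all

variable (S S' : H →L[ℂ] H) (T T' : K →L[ℂ] K)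

theorem opTensor_add_left : opTensor (S + S') T = opTensor S T + opTensor S' T :=
  operator_ext fun _ _ => by simp [opTensor_inclusion_tmul, TensorProduct.add_tmul]

theorem opTensor_add_right : opTensor S (T + T') = opTensor S T + opTensor S T' :=
  operator_ext fun _ _ => by simp [opTensor_inclusion_tmul, TensorProduct.tmul_add]

theorem opTensor_smul_left (c : ℂ) : opTensor (c • S) T = c • opTensor S T :=
  operator_ext fun _ _ => by simp [opTensor_inclusion_tmul, ← TensorProduct.smul_tmul']

theorem opTensor_smul_right (c : ℂ) : opTensor S (c • T) = c • opTensor S T :=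
  operator_ext fun _ _ => by simp [opTensor_inclusion_tmul]

theorem opTensor_mul : opTensor (S * S') (T * T') = opTensor S T * opTensor S' T' :=
  operator_ext fun _ _ => by simp [opTensor_inclusion_tmul]

theorem opTensor_one : opTensor (1 : H →L[ℂ] H) (1 : K →L[ℂ] K) = 1 :=
  operator_ext fun _ _ => by simp [opTensor_inclusion_tmul]

theorem opTensor_star [CompleteSpace H] [CompleteSpace K] :
    opTensor (star S) (star T) = star (opTensor S T) := by
  rw [ContinuousLinearMap.star_eq_adjoint (opTensor S T), ContinuousLinearMap.eq_adjoint_iff]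
  intro x y
  induction x using denseRange_inclusion.induction_on with
  | hp => exact isClosed_eq (by fun_prop) (by fun_prop)
  | ih x =>
  induction y using denseRange_inclusion.induction_on with
  | hp => exact isClosed_eq (by fun_prop) (by fun_prop)
  | ih y =>
  simp only [opTensor_inclusion, LinearIsometry.inner_map_map]
  induction x using TensorProduct.induction_on with
  | zero => simp
  | add z w hz hw => simp_all [inner_add_left]
  | tmul x x' =>
  induction y using TensorProduct.induction_on with
  | zero => simp
  | add z w hz hw => simp_all [inner_add_right]
  | tmul y y' =>
    simp [ContinuousLinearMap.star_eq_adjoint, ContinuousLinearMap.adjoint_inner_left]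

end Hilbert

/-! ### Amplified representations -/

section MatrixRepresentation

variable {A H : Type*} [CStarAlgebra A] [PartialOrder A] [StarOrderedRing A]
  [NormedAddCommGroup H] [InnerProductSpace ℂ H] [CompleteSpace H]
  {m : Type*} [Fintype m]

/-- The amplification of a representation `π` of `A` on `H` to a representation of `M_m(A)` on
`H^m`. -/
noncomputable def matrixRep (π : A →⋆ₐ[ℂ] (H →L[ℂ] H)) :
    CStarMatrix m m A →⋆ₙₐ[ℂ] (PiLp 2 (fun _ : m => H) →L[ℂ] PiLp 2 (fun _ : m => H)) where
  toFun X := (PiLp.continuousLinearEquiv 2 ℂ fun _ : m => H).symm.toContinuousLinearMap ∘L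
    ContinuousLinearMap.pi fun i => ∑ j, π (X i j) ∘L PiLp.proj 2 (fun _ : m => H) j
  map_zero' := by ext; simp
  map_add' X Y := by ext; simp [Finset.sum_add_distrib]
  map_smul' c X := by ext; simp [Finset.smul_sum]
  map_mul' X Y := by
    ext h i
    simp only [ContinuousLinearMap.comp_apply, mul_apply_eq_comp,
      ContinuousLinearMap.pi_apply, ContinuousLinearEquiv.coe_coe, CStarMatrix.mul_apply,
      PiLp.continuousLinearEquiv_symm_apply, sum_apply, PiLp.proj_apply,
      map_sum, map_mul]
    exact Finset.sum_comm
  map_star' X := by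
    rw [ContinuousLinearMap.star_eq_adjoint, ContinuousLinearMap.eq_adjoint_iff]
    intro x y
    simp only [PiLp.inner_apply, ContinuousLinearMap.comp_apply, ContinuousLinearMap.pi_apply,
      ContinuousLinearEquiv.coe_coe, PiLp.continuousLinearEquiv_symm_apply,
      sum_apply, PiLp.proj_apply, sum_inner, inner_sum, CStarMatrix.star_apply,
      map_star, ContinuousLinearMap.star_eq_adjoint, ContinuousLinearMap.adjoint_inner_left]
    exact Finset.sum_comm

theorem matrixRep_apply (π : A →⋆ₐ[ℂ] (H →L[ℂ] H)) (X : CStarMatrix m m A)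
    (h : PiLp 2 (fun _ : m => H)) (i : m) : matrixRep π X h i = ∑ j, π (X i j) (h j) := by
  simp [matrixRep]

/-- The amplification of a faithful representation is faithful, hence isometric. -/
theorem norm_matrixRep [DecidableEq m] (π : A →⋆ₐ[ℂ] (H →L[ℂ] H)) (hπ : Function.Injective π)
    (X : CStarMatrix m m A) : ‖matrixRep π X‖ = ‖X‖ := by
  refine NonUnitalStarAlgHom.norm_map (matrixRep π) ?_ X
  rw [injective_iff_map_eq_zero]
  intro X hX
  ext i j
  refine hπ ?_
  ext h
  -- evaluate at the vector with `h` in position `j` and `0` elsewhere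
  have := congrArg (fun T => T (WithLp.toLp 2 (Pi.single j h)) i) hX
  simpa [matrixRep_apply, Pi.single_apply, apply_ite] using this

end MatrixRepresentation

/-! ### Column isometries -/

section Columns

variable {H K : Type*} [NormedAddCommGroup H] [InnerProductSpace ℂ H]
  [NormedAddCommGroup K] [InnerProductSpace ℂ K] {m : Type*} [Fintype m] {e : m → K}

/-- The isometry `h ↦ ∑ hᵢ ⊗ eᵢ` from `H^m` to `H ⊗ K` given by an orthonormal family in `K`. -/
noncomputable def columnIsometry (e : m → K) (he : Orthonormal ℂ e) :
    PiLp 2 (fun _ : m => H) →ₗᵢ[ℂ] HilbertTensor H K where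
  toLinearMap := inclusion.toLinearMap ∘ₗ
    ∑ i, (TensorProduct.mk ℂ H K).flip (e i) ∘ₗ PiLp.projₗ 2 (fun _ : m => H) i
  norm_map' h := by
    classical
    rw [← sq_eq_sq₀ (norm_nonneg _) (norm_nonneg _), PiLp.norm_sq_eq_of_L2]
    simp only [LinearMap.comp_apply, LinearIsometry.coe_toLinearMap, LinearIsometry.norm_map,
      LinearMap.sum_apply, LinearMap.flip_apply, TensorProduct.mk_apply]
    rw [← Complex.ofReal_inj, Complex.ofReal_pow]
    refine (inner_self_eq_norm_sq_to_K (𝕜 := ℂ)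
      (∑ i, h i ⊗ₜ[ℂ] e i)).symm.trans ?_
    simp only [sum_inner, inner_sum, TensorProduct.inner_tmul]
    simp [orthonormal_iff_ite.mp he, inner_self_eq_norm_sq_to_K]

theorem columnIsometry_apply (he : Orthonormal ℂ e) (h : PiLp 2 (fun _ : m => H)) :
    columnIsometry e he h = inclusion (∑ i, h i ⊗ₜ e i) := by
  simp [columnIsometry]

/-- Finitely many vectors of the algebraic tensor product lie in the range of one and the same
column isometry. -/
theorem exists_columnIsometry_eq (x y : H ⊗[ℂ] K) :
    ∃ (n : ℕ) (e : Fin n → K) (he : Orthonormal ℂ e) (h h' : PiLp 2 (fun _ : Fin n => H)),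
      columnIsometry e he h = inclusion x ∧ columnIsometry e he h' = inclusion y := by
  obtain ⟨N, hN, hxy⟩ := TensorProduct.exists_finite_submodule_right_of_setFinite {x, y}
    (Set.toFinite _)
  let b := stdOrthonormalBasis ℂ N
  have he : Orthonormal ℂ (fun i => (b i : K)) := b.orthonormal.comp_linearIsometry N.subtypeₗᵢ
  have key : ∀ z : H ⊗[ℂ] N, ∃ h, columnIsometry _ he h = inclusion (N.subtype.lTensor H z) := by
    intro z
    induction z using TensorProduct.induction_on with
    | zero => exact ⟨0, by simp⟩
    | add z w hz hw =>
      obtain ⟨h, hh⟩ := hz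
      obtain ⟨h', hh'⟩ := hw
      exact ⟨h + h', by simp [hh, hh']⟩
    | tmul h k =>
      refine ⟨WithLp.toLp 2 fun i => inner ℂ (b i) k • h, ?_⟩
      rw [columnIsometry_apply]
      congr 1
      conv_rhs => rw [← b.sum_repr' k]
      simp [TensorProduct.tmul_sum, TensorProduct.smul_tmul']
  obtain ⟨x', hx'⟩ := hxy (Set.mem_insert x _)
  obtain ⟨y', hy'⟩ := hxy (Set.mem_insert_of_mem x rfl)
  obtain ⟨h, hh⟩ := key x'
  obtain ⟨h', hh'⟩ := key y'
  exact ⟨_, _, he, h, h', by rw [hh, hx'], by rw [hh', hy']⟩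

end Columns

/-! ### Slices of elements of the minimal tensor product -/

section Compression

variable {A P H K : Type*} [CStarAlgebra A] [CStarAlgebra P]
  [NormedAddCommGroup H] [InnerProductSpace ℂ H] [CompleteSpace H]
  [NormedAddCommGroup K] [InnerProductSpace ℂ K] [CompleteSpace K]
  {m : Type*} {e : m → K}

variable (π : A →⋆ₐ[ℂ] (H →L[ℂ] H)) (ρ : P →⋆ₐ[ℂ] (K →L[ℂ] K))

theorem tmul_add (a : A) (p q : P) : tmul π ρ a (p + q) = tmul π ρ a p + tmul π ρ a q :=
  Subtype.ext (by simp [tmul, opTensor_add_right])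

theorem add_tmul (a b : A) (p : P) : tmul π ρ (a + b) p = tmul π ρ a p + tmul π ρ b p :=
  Subtype.ext (by simp [tmul, opTensor_add_left])

theorem smul_tmul (c : ℂ) (a : A) (p : P) : tmul π ρ (c • a) p = c • tmul π ρ a p :=
  Subtype.ext (by simp [tmul, opTensor_smul_left])

theorem tmul_smul (c : ℂ) (a : A) (p : P) : tmul π ρ a (c • p) = c • tmul π ρ a p :=
  Subtype.ext (by simp [tmul, opTensor_smul_right])

theorem tmul_mul_tmul (a b : A) (p q : P) :
    tmul π ρ a p * tmul π ρ b q = tmul π ρ (a * b) (p * q) :=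
  Subtype.ext (by simp [tmul, opTensor_mul])

theorem one_tmul_one : tmul π ρ 1 1 = 1 :=
  Subtype.ext (by simp [tmul, opTensor_one])

theorem star_tmul (a : A) (p : P) : star (tmul π ρ a p) = tmul π ρ (star a) (star p) :=
  Subtype.ext (by simp [tmul, ← opTensor_star, map_star])

/-- The canonical map from the algebraic to the minimal tensor product. -/
noncomputable def ofAlgTensor : A ⊗[ℂ] P →ₗ[ℂ] MinTensor π ρ :=
  TensorProduct.lift (LinearMap.mk₂ ℂ (tmul π ρ) (add_tmul π ρ) (smul_tmul π ρ) (tmul_add π ρ)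
    (tmul_smul π ρ))

@[simp]
theorem ofAlgTensor_tmul (a : A) (p : P) : ofAlgTensor π ρ (a ⊗ₜ p) = tmul π ρ a p := rfl

/-- The slice map `A ⊗ P → M_m(A)`, `a ⊗ p ↦ (⟨eᵢ, ρ(p) eⱼ⟩ a)ᵢⱼ`. -/
noncomputable def sliceMatrix (e : m → K) : A ⊗[ℂ] P →ₗ[ℂ] CStarMatrix m m A :=
  TensorProduct.lift (LinearMap.mk₂ ℂ
    (fun a p => CStarMatrix.ofMatrix fun i j => inner ℂ (e i) (ρ p (e j)) • a)
    (fun a b p => by ext i j; exact smul_add (inner ℂ (e i) (ρ p (e j))) a b)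
    (fun c a p => by ext i j; exact smul_comm (inner ℂ (e i) (ρ p (e j))) c a)
    (fun a p q => by
      ext i j
      change inner ℂ (e i) (ρ (p + q) (e j)) • a =
        inner ℂ (e i) (ρ p (e j)) • a + inner ℂ (e i) (ρ q (e j)) • a
      simp [add_smul])
    (fun c a p => by
      ext i j
      change inner ℂ (e i) (ρ (c • p) (e j)) • a = c • (inner ℂ (e i) (ρ p (e j)) • a)
      simp [mul_smul]))

@[simp]
theorem sliceMatrix_tmul (a : A) (p : P) (i j : m) :
    sliceMatrix ρ e (a ⊗ₜ p) i j = inner ℂ (e i) (ρ p (e j)) • a := rfl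

theorem sliceMatrix_rTensor (E : A →ₗ[ℂ] A) (t : A ⊗[ℂ] P) :
    sliceMatrix ρ e (E.rTensor P t) = CStarMatrix.mapₗ E (sliceMatrix ρ e t) := by
  induction t using TensorProduct.induction_on with
  | zero => simp only [map_zero]
  | add t s ht hs => simp only [map_add, ht, hs]
  | tmul a p => ext i j; simp [CStarMatrix.mapₗ]

variable [PartialOrder A] [StarOrderedRing A] [Fintype m]

/-- Compressing an element of the algebraic tensor product by the column isometry gives its slice
matrix. -/
theorem inner_ofAlgTensor_columnIsometry (he : Orthonormal ℂ e) (t : A ⊗[ℂ] P)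
    (h h' : PiLp 2 (fun _ : m => H)) :
    inner ℂ (columnIsometry e he h)
      ((ofAlgTensor π ρ t : HilbertTensor H K →L[ℂ] HilbertTensor H K) (columnIsometry e he h')) =
    inner ℂ h (matrixRep π (sliceMatrix ρ e t) h') := by
  induction t using TensorProduct.induction_on with
  | zero => simp
  | add t s ht hs => simp [ht, hs]
  | tmul a p =>
    simp only [columnIsometry_apply, ofAlgTensor_tmul, tmul, map_sum, opTensor_inclusion_tmul,
      sum_inner, inner_sum, LinearIsometry.inner_map_map, TensorProduct.inner_tmul,
      PiLp.inner_apply, matrixRep_apply, sliceMatrix_tmul, map_smul,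
      smul_apply, inner_smul_right]
    rw [Finset.sum_comm]
    exact Finset.sum_congr rfl fun _ _ => Finset.sum_congr rfl fun _ _ => mul_comm _ _

theorem norm_sliceMatrix_le [DecidableEq m] (hπ : Function.Injective π) (he : Orthonormal ℂ e) (t : A ⊗[ℂ] P) :
    ‖sliceMatrix ρ e t‖ ≤ ‖ofAlgTensor π ρ t‖ := by
  rw [← norm_matrixRep π hπ]
  refine ContinuousLinearMap.opNorm_le_of_re_inner_le (𝕜 := ℂ) (norm_nonneg _) fun x y hx hy => ?_
  refine (RCLike.re_le_norm _).trans ?_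
  rw [norm_inner_symm, ← inner_ofAlgTensor_columnIsometry π ρ he]
  refine (norm_inner_le_norm _ _).trans ?_
  grw [ContinuousLinearMap.le_opNorm]
  simp [hx, hy]

end Compression

/-! ### Boundedness of the tensored expectation -/

section

variable {A P H K : Type*} [CStarAlgebra A] [CStarAlgebra P]
  [NormedAddCommGroup H] [InnerProductSpace ℂ H] [CompleteSpace H]
  [NormedAddCommGroup K] [InnerProductSpace ℂ K] [CompleteSpace K]
  {π : A →⋆ₐ[ℂ] (H →L[ℂ] H)} {B : StarSubalgebra ℂ A} {E : A →ₗ[ℂ] A}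

/-- `E ⊗ id` is contractive for the spatial norm: on the vectors of the algebraic Hilbert space
tensor product both norms are computed by slice matrices, on which `E` acts entrywise. -/
theorem norm_ofAlgTensor_rTensor_le (hπ : Function.Injective π) (ρ : P →⋆ₐ[ℂ] (K →L[ℂ] K))
    (hE : IsConditionalExpectation B E) (hfin : HasFiniteIndex E) (t : A ⊗[ℂ] P) :
    ‖ofAlgTensor π ρ (E.rTensor P t)‖ ≤ ‖ofAlgTensor π ρ t‖ := by
  let := CStarAlgebra.spectralOrder A
  have := CStarAlgebra.spectralOrderedRing A
  have key : ∀ x y : HilbertTensor H K,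
      ‖inner ℂ x ((ofAlgTensor π ρ (E.rTensor P t) :
        HilbertTensor H K →L[ℂ] HilbertTensor H K) y)‖ ≤ ‖ofAlgTensor π ρ t‖ * ‖x‖ * ‖y‖ := by
    intro x y
    induction x using denseRange_inclusion.induction_on with
    | hp => exact isClosed_le (by fun_prop) (by fun_prop)
    | ih x =>
    induction y using denseRange_inclusion.induction_on with
    | hp => exact isClosed_le (by fun_prop) (by fun_prop)
    | ih y =>
    obtain ⟨n, e, he, h, h', hx, hy⟩ := exists_columnIsometry_eq x y
    rw [← hx, ← hy, inner_ofAlgTensor_columnIsometry, LinearIsometry.norm_map,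
      LinearIsometry.norm_map, sliceMatrix_rTensor]
    grw [norm_inner_le_norm, ContinuousLinearMap.le_opNorm, norm_matrixRep π hπ,
      norm_mapₗ_le hE hfin, norm_sliceMatrix_le π ρ hπ he]
    exact le_of_eq (by ring)
  refine ContinuousLinearMap.opNorm_le_of_re_inner_le (𝕜 := ℂ) (norm_nonneg _) fun x y hx hy => ?_
  refine (RCLike.re_le_norm _).trans ?_
  rw [norm_inner_symm]
  simpa [hx, hy] using key y x

end

variable {A P H K : Type*} [CStarAlgebra A] [CStarAlgebra P]
  [NormedAddCommGroup H] [InnerProductSpace ℂ H] [CompleteSpace H]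
  [NormedAddCommGroup K] [InnerProductSpace ℂ K] [CompleteSpace K]

/-! ### Density of the elementary tensors -/

section Density

variable (π : A →⋆ₐ[ℂ] (H →L[ℂ] H)) (ρ : P →⋆ₐ[ℂ] (K →L[ℂ] K))

theorem ofAlgTensor_mul (s t : A ⊗[ℂ] P) :
    ofAlgTensor π ρ (s * t) = ofAlgTensor π ρ s * ofAlgTensor π ρ t := by
  induction s using TensorProduct.induction_on with
  | zero => simp
  | add s s' hs hs' => simp [add_mul, hs, hs']
  | tmul a p =>
  induction t using TensorProduct.induction_on with
  | zero => simp
  | add t t' ht ht' => simp_all [mul_add]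
  | tmul b q => simp [tmul_mul_tmul]

theorem star_ofAlgTensor_mem_range (s : A ⊗[ℂ] P) :
    star (ofAlgTensor π ρ s) ∈ Set.range (ofAlgTensor π ρ) := by
  induction s using TensorProduct.induction_on with
  | zero => exact ⟨0, by simp⟩
  | add s t hs ht =>
    obtain ⟨s', hs'⟩ := hs
    obtain ⟨t', ht'⟩ := ht
    exact ⟨s' + t', by simp [hs', ht']⟩
  | tmul a p => exact ⟨star a ⊗ₜ star p, by simp [star_tmul]⟩

theorem denseRange_ofAlgTensor : DenseRange (ofAlgTensor π ρ) := by
  intro x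
  rw [closure_subtype]
  refine closure_mono ?_ x.2
  intro T hT
  induction hT using StarAlgebra.adjoin_induction with
  | mem T hT =>
    obtain ⟨a, p, rfl⟩ := hT
    exact ⟨tmul π ρ a p, ⟨a ⊗ₜ p, rfl⟩, rfl⟩
  | algebraMap c =>
    refine ⟨c • tmul π ρ 1 1, ⟨c • 1 ⊗ₜ 1, by simp⟩, ?_⟩
    rw [one_tmul_one, Algebra.algebraMap_eq_smul_one]
    rfl
  | add S T _ _ hS hT =>
    obtain ⟨_, ⟨s, rfl⟩, rfl⟩ := hS
    obtain ⟨_, ⟨t, rfl⟩, rfl⟩ := hT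
    exact ⟨_, ⟨s + t, rfl⟩, by simp⟩
  | mul S T _ _ hS hT =>
    obtain ⟨_, ⟨s, rfl⟩, rfl⟩ := hS
    obtain ⟨_, ⟨t, rfl⟩, rfl⟩ := hT
    refine ⟨_, ⟨s * t, rfl⟩, ?_⟩
    rw [ofAlgTensor_mul]
    rfl
  | star S _ hS =>
    obtain ⟨_, ⟨s, rfl⟩, rfl⟩ := hS
    exact ⟨star (ofAlgTensor π ρ s), star_ofAlgTensor_mem_range π ρ s, rfl⟩

variable {π ρ}

/-- A closed additive property of elements of the minimal tensor product holds everywhere if it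
holds for elementary tensors. -/
theorem induction_tmul {p : MinTensor π ρ → Prop} (x : MinTensor π ρ)
    (closed : IsClosed {x | p x}) (zero : p 0) (tmul : ∀ a q, p (tmul π ρ a q))
    (add : ∀ x y, p x → p y → p (x + y)) : p x := by
  induction x using (denseRange_ofAlgTensor π ρ).induction_on with
  | hp => exact closed
  | ih t =>
  induction t using TensorProduct.induction_on with
  | zero => simpa using zero
  | add s t hs ht => simpa using add _ _ hs ht
  | tmul a q => exact tmul a q

theorem isClosed_sub (S : StarSubalgebra ℂ A) : IsClosed (sub π ρ S : Set (MinTensor π ρ)) :=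
  StarSubalgebra.isClosed_topologicalClosure _

theorem tmul_mem_sub {S : StarSubalgebra ℂ A} {a : A} (ha : a ∈ S) (p : P) :
    tmul π ρ a p ∈ sub π ρ S :=
  StarSubalgebra.le_topologicalClosure _ (StarAlgebra.subset_adjoin ℂ _ ⟨a, ha, p, rfl⟩)

theorem sub_mono {S T : StarSubalgebra ℂ A} (h : S ≤ T) : sub π ρ S ≤ sub π ρ T :=
  StarSubalgebra.topologicalClosure_mono
    (StarAlgebra.adjoin_mono fun _ ⟨a, ha, p, hx⟩ => ⟨a, h ha, p, hx⟩)

end Density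

/-! ### The tensored expectation -/

section Expectation

variable (π : A →⋆ₐ[ℂ] (H →L[ℂ] H)) (ρ : P →⋆ₐ[ℂ] (K →L[ℂ] K))

/-- The map `E ⊗ id` on the minimal tensor product: the continuous extension of
`a ⊗ p ↦ E(a) ⊗ p`. It has this meaning when `E` is a conditional expectation of finite index, so
that the algebraic map is bounded, see `tensorId_tmul`. -/
noncomputable def tensorId (E : A →ₗ[ℂ] A) : MinTensor π ρ →L[ℂ] MinTensor π ρ :=
  (ofAlgTensor π ρ ∘ₗ E.rTensor P).extendOfNorm (ofAlgTensor π ρ)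

variable {π} {B C : StarSubalgebra ℂ A} {E F : A →ₗ[ℂ] A}

theorem tensorId_tmul (hπ : Function.Injective π) (hE : IsConditionalExpectation B E)
    (hfin : HasFiniteIndex E) (a : A) (p : P) :
    tensorId π ρ E (tmul π ρ a p) = tmul π ρ (E a) p :=
  LinearMap.extendOfNorm_eq (denseRange_ofAlgTensor π ρ)
    ⟨1, fun t => by simpa using norm_ofAlgTensor_rTensor_le hπ ρ hE hfin t⟩ (a ⊗ₜ p)

theorem star_tensorId (hπ : Function.Injective π) (hE : IsConditionalExpectation B E)
    (hfin : HasFiniteIndex E) (x : MinTensor π ρ) :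
    tensorId π ρ E (star x) = star (tensorId π ρ E x) := by
  induction x using induction_tmul with
  | closed => exact isClosed_eq (by fun_prop) (by fun_prop)
  | zero => simp
  | tmul a p => simp [star_tmul, tensorId_tmul ρ hπ hE hfin, hE.map_star]
  | add x y hx hy => simp [hx, hy]

theorem tensorId_mem (hπ : Function.Injective π) (hE : IsConditionalExpectation B E)
    (hfin : HasFiniteIndex E) (x : MinTensor π ρ) : tensorId π ρ E x ∈ sub π ρ B := by
  induction x using induction_tmul with
  | closed => exact (isClosed_sub B).preimage (tensorId π ρ E).continuous
  | zero => simp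
  | tmul a p => simpa [tensorId_tmul ρ hπ hE hfin] using tmul_mem_sub (hE.mem a) p
  | add x y hx hy => simpa using add_mem hx hy

theorem tensorId_mul_right (hπ : Function.Injective π) (hE : IsConditionalExpectation B E)
    (hfin : HasFiniteIndex E) {z : MinTensor π ρ} (hz : z ∈ sub π ρ B) (x : MinTensor π ρ) :
    tensorId π ρ E (x * z) = tensorId π ρ E x * z := by
  -- the left-handed statement is carried along for the step from `z` to `star z`
  suffices h : ∀ z ∈ sub π ρ B, ∀ x, tensorId π ρ E (x * z) = tensorId π ρ E x * z ∧
      tensorId π ρ E (z * x) = z * tensorId π ρ E x from (h z hz x).1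
  have hclosed : IsClosed {z | ∀ x, tensorId π ρ E (x * z) = tensorId π ρ E x * z ∧
      tensorId π ρ E (z * x) = z * tensorId π ρ E x} := by
    simp only [Set.ofPred_forall, Set.ofPred_and]
    exact isClosed_iInter fun x => (isClosed_eq (by fun_prop) (by fun_prop)).inter
      (isClosed_eq (by fun_prop) (by fun_prop))
  refine closure_minimal (fun z hz => ?_) hclosed
  induction hz using StarAlgebra.adjoin_induction with
  | mem z hz =>
    obtain ⟨b, hb, q, rfl⟩ := hz
    intro x
    induction x using induction_tmul with
    | closed =>
      exact (isClosed_eq (by fun_prop) (by fun_prop)).inter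
        (isClosed_eq (by fun_prop) (by fun_prop))
    | zero => simp
    | tmul a p =>
      simp [tmul_mul_tmul, tensorId_tmul ρ hπ hE hfin, hE.right_mul b hb, hE.left_mul b hb]
    | add x y hx hy => simp [add_mul, mul_add, hx, hy]
  | algebraMap c =>
    intro x
    simp only [Algebra.algebraMap_eq_smul_one, mul_smul_one, smul_one_mul, map_smul, and_self]
  | add z w _ _ hz hw => exact fun x => by simp [add_mul, mul_add, hz x, hw x]
  | mul z w _ _ hz hw =>
    intro x
    rw [← mul_assoc, (hw _).1, (hz x).1, mul_assoc z w x, (hz _).2, (hw x).2, mul_assoc, mul_assoc]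
    exact ⟨rfl, rfl⟩
  | star z _ hz =>
    intro x
    have h1 := congrArg star (hz (star x)).1
    have h2 := congrArg star (hz (star x)).2
    simp only [← star_tensorId ρ hπ hE hfin, star_mul, star_star] at h1 h2
    exact ⟨h2, h1⟩

theorem isQuasiBasis_tensorId (hπ : Function.Injective π) (hE : IsConditionalExpectation B E)
    {n : ℕ} {u : Fin n → A} (hu : IsQuasiBasis E u) :
    IsQuasiBasis (tensorId π ρ E).toLinearMap fun i => tmul π ρ (u i) 1 := by
  intro x
  induction x using induction_tmul with
  | closed => exact isClosed_eq continuous_id (by simp only [ContinuousLinearMap.coe_coe]; fun_prop)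
  | zero => simp
  | tmul a p =>
    simp only [star_tmul, tmul_mul_tmul, ContinuousLinearMap.coe_coe,
      tensorId_tmul ρ hπ hE ⟨n, u, hu⟩, star_one, one_mul]
    conv_lhs => rw [hu a]
    exact map_sum (AddMonoidHom.mk' (fun a => tmul π ρ a p) fun a b => add_tmul π ρ a b p) _ _
  | add x y hx hy =>
    conv_lhs => rw [hx, hy]
    simp [mul_add, Finset.sum_add_distrib]

theorem isConditionalExpectation_tensorId (hπ : Function.Injective π)
    (hE : IsConditionalExpectation B E) (hfin : HasFiniteIndex E) :
    IsConditionalExpectation (sub π ρ B) (tensorId π ρ E).toLinearMap := by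
  obtain ⟨n, u, hu⟩ := id hfin
  have hone : tensorId π ρ E 1 = 1 := by
    rw [← one_tmul_one, tensorId_tmul ρ hπ hE hfin, hE.map_one]
  refine isConditionalExpectation_of_isQuasiBasis (isClosed_sub B) (tensorId_mem ρ hπ hE hfin) ?_
    (fun b hb x => tensorId_mul_right ρ hπ hE hfin hb x) (star_tensorId ρ hπ hE hfin)
    (isQuasiBasis_tensorId ρ hπ hE hu)
  intro b hb
  simpa [hone] using tensorId_mul_right ρ hπ hE hfin hb 1

theorem isCompatible_tensorId (hπ : Function.Injective π)
    (hE : IsConditionalExpectation B E) (hfin : HasFiniteIndex E) (h : IsCompatible B E C F) :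
    IsCompatible (sub π ρ B) (tensorId π ρ E).toLinearMap (sub π ρ C)
      (tensorId π ρ F).toLinearMap where
  le := sub_mono h.le
  isClosed := isClosed_sub C
  condExp := isConditionalExpectation_tensorId ρ hπ h.condExp h.finiteIndex
  finiteIndex := by
    obtain ⟨n, v, hv⟩ := h.finiteIndex
    exact ⟨n, _, isQuasiBasis_tensorId ρ hπ h.condExp hv⟩
  comp_eq := by
    ext x : 1
    simp only [LinearMap.comp_apply, ContinuousLinearMap.coe_coe]
    induction x using induction_tmul with
    | closed => exact isClosed_eq (by fun_prop) (by fun_prop)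
    | zero => simp
    | tmul a p =>
      simp [tensorId_tmul ρ hπ hE hfin, tensorId_tmul ρ hπ h.condExp h.finiteIndex, h.map_map]
    | add x y hx hy => simp [hx, hy]

end Expectation

/-! ### The embedding of the left factor -/

section LeftFactor

variable (π : A →⋆ₐ[ℂ] (H →L[ℂ] H)) (ρ : P →⋆ₐ[ℂ] (K →L[ℂ] K))

/-- The embedding `a ↦ a ⊗ 1` of `A` into the minimal tensor product. -/
noncomputable def includeLeft : A →⋆ₐ[ℂ] MinTensor π ρ where
  toFun a := tmul π ρ a 1
  map_one' := one_tmul_one π ρ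
  map_mul' a b := by simp [tmul_mul_tmul]
  map_zero' := by simpa using smul_tmul π ρ 0 0 1
  map_add' a b := add_tmul π ρ a b 1
  commutes' c := by
    rw [Algebra.algebraMap_eq_smul_one, smul_tmul, one_tmul_one, Algebra.algebraMap_eq_smul_one]
  map_star' a := by simp [star_tmul]

theorem includeLeft_apply (a : A) : includeLeft π ρ a = tmul π ρ a 1 := rfl

variable {π ρ}

theorem includeLeft_injective [Nontrivial P] (hπ : Function.Injective π)
    (hρ : Function.Injective ρ) : Function.Injective (includeLeft π ρ) := by
  -- a nonzero algebra has no faithful unital representation on the zero space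
  have : Nontrivial K := by
    by_contra hK
    rw [not_nontrivial_iff_subsingleton] at hK
    exact one_ne_zero (α := P) (hρ (by ext x; exact Subsingleton.elim _ _))
  obtain ⟨k, hk⟩ := exists_ne (0 : K)
  rw [injective_iff_map_eq_zero]
  intro a ha
  refine (map_eq_zero_iff π hπ).mp ?_
  ext h
  have h0 : opTensor (π a) (ρ 1) (inclusion (h ⊗ₜ k)) = 0 := by
    rw [show opTensor (π a) (ρ 1) = 0 from congrArg Subtype.val ha]
    rfl
  have h1 := congrArg norm h0
  simpa [opTensor_inclusion_tmul, hk] using h1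

/-- Spectral permanence: inverting a self-adjoint element commutes with `a ↦ a ⊗ 1`, also when one
side, hence the other, is the junk value `0`. -/
theorem ringInverse_includeLeft [Nontrivial P] (hπ : Function.Injective π)
    (hρ : Function.Injective ρ) {a : A} (ha : IsSelfAdjoint a) :
    Ring.inverse (includeLeft π ρ a) = includeLeft π ρ (Ring.inverse a) := by
  by_cases h : IsUnit a
  · obtain ⟨v, rfl⟩ := h
    rw [Ring.inverse_unit]
    exact Ring.inverse_unit (v.map (includeLeft π ρ : A →* MinTensor π ρ))
  · have h' : ¬IsUnit (includeLeft π ρ a) := by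
      rw [← spectrum.zero_mem_iff ℝ] at h ⊢
      rwa [ha.map_spectrum_real _ (includeLeft_injective hπ hρ)]
    rw [Ring.inverse_non_unit _ h, Ring.inverse_non_unit _ h', map_zero]

end LeftFactor

/-! ### Index and angle of the tensored inclusion -/

section Angle

variable {π : A →⋆ₐ[ℂ] (H →L[ℂ] H)} (ρ : P →⋆ₐ[ℂ] (K →L[ℂ] K))
  {B C D : StarSubalgebra ℂ A} {E F G : A →ₗ[ℂ] A}

theorem watataniIndex_tensorId (hπ : Function.Injective π) (hE : IsConditionalExpectation B E)
    (hfin : HasFiniteIndex E) :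
    watataniIndex (tensorId π ρ E).toLinearMap = includeLeft π ρ (watataniIndex E) := by
  have hEP := isConditionalExpectation_tensorId ρ hπ hE hfin
  obtain ⟨n, u, hu⟩ := hfin
  rw [watataniIndex_eq hEP (isQuasiBasis_tensorId ρ hπ hE hu), watataniIndex_eq hE hu, map_sum]
  simp only [← includeLeft_apply, map_mul, map_star]

theorem isSelfAdjoint_watataniIndex (hE : IsConditionalExpectation B E)
    (hfin : HasFiniteIndex E) : IsSelfAdjoint (watataniIndex E) := by
  obtain ⟨n, u, hu⟩ := hfin
  rw [watataniIndex_eq hE hu]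
  simp [IsSelfAdjoint]

/-- With the quasi-basis `uᵢ ⊗ 1` all terms of the inner product lie in `A ⊗ 1`. -/
theorem basicInner_tensorId [Nontrivial P] (hπ : Function.Injective π)
    (hρ : Function.Injective ρ) (hE : IsConditionalExpectation B E) (hfin : HasFiniteIndex E)
    (hF : IsCompatible B E C F) (hG : IsCompatible B E D G) :
    basicInner (tensorId π ρ E).toLinearMap
        (jonesProj (tensorId π ρ F).toLinearMap - jonesProj (tensorId π ρ E).toLinearMap)
        (jonesProj (tensorId π ρ G).toLinearMap - jonesProj (tensorId π ρ E).toLinearMap) =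
      includeLeft π ρ (basicInner E (jonesProj F - jonesProj E) (jonesProj G - jonesProj E)) := by
  have hEP := isConditionalExpectation_tensorId ρ hπ hE hfin
  have hFP := isCompatible_tensorId ρ hπ hE hfin hF
  have hGP := isCompatible_tensorId ρ hπ hE hfin hG
  obtain ⟨n, u, hu⟩ := id hfin
  have left : ∀ {C F}, IsCompatible B E C F → ∀ a,
      ((tensorId π ρ F).toLinearMap - (tensorId π ρ E).toLinearMap) (includeLeft π ρ a) =
        includeLeft π ρ ((F - E) a) := fun h a => by
    simp only [LinearMap.sub_apply, ContinuousLinearMap.coe_coe, map_sub]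
    simp only [includeLeft_apply, tensorId_tmul ρ hπ hE hfin,
      tensorId_tmul ρ hπ h.condExp h.finiteIndex]
  rw [basicInner_compatible hEP (isQuasiBasis_tensorId ρ hπ hE hu) hFP hGP,
    basicInner_compatible hE hu hF hG, watataniIndex_tensorId ρ hπ hE hfin,
    ringInverse_includeLeft hπ hρ (isSelfAdjoint_watataniIndex hE hfin), map_mul, map_sum]
  simp only [← includeLeft_apply, left hF, left hG, map_mul, map_star]

theorem interiorAngle_tensorId [Nontrivial P] (hπ : Function.Injective π)
    (hρ : Function.Injective ρ) (hE : IsConditionalExpectation B E) (hfin : HasFiniteIndex E)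
    (hC : C ∈ IMS B E) (hD : D ∈ IMS B E) :
    interiorAngle (sub π ρ B) (tensorId π ρ E).toLinearMap (sub π ρ C) (sub π ρ D) =
      interiorAngle B E C D := by
  obtain ⟨F, hF⟩ := hC
  obtain ⟨G, hG⟩ := hD
  have hEP := isConditionalExpectation_tensorId ρ hπ hE hfin
  have hfinP : HasFiniteIndex (tensorId π ρ E).toLinearMap := by
    obtain ⟨n, u, hu⟩ := hfin
    exact ⟨n, _, isQuasiBasis_tensorId ρ hπ hE hu⟩
  have norm_left := NonUnitalStarAlgHom.norm_map (includeLeft π ρ) (includeLeft_injective hπ hρ)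
  simp only [interiorAngle, basicNorm, hF.compatibleExp_eq hE hfin, hG.compatibleExp_eq hE hfin,
    (isCompatible_tensorId ρ hπ hE hfin hF).compatibleExp_eq hEP hfinP,
    (isCompatible_tensorId ρ hπ hE hfin hG).compatibleExp_eq hEP hfinP,
    basicInner_tensorId ρ hπ hρ hE hfin hF hG, basicInner_tensorId ρ hπ hρ hE hfin hF hF,
    basicInner_tensorId ρ hπ hρ hE hfin hG hG, norm_left]

end Angle

end MinimalTensor

open CStarIndex MinimalTensor in
theorem mainTheorem1
    {A P H K : Type*} [CStarAlgebra A] [CStarAlgebra P]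
    [NormedAddCommGroup H] [InnerProductSpace ℂ H] [CompleteSpace H]
    [NormedAddCommGroup K] [InnerProductSpace ℂ K] [CompleteSpace K]
    (π : A →⋆ₐ[ℂ] (H →L[ℂ] H)) (hπ : Function.Injective π)
    (ρ : P →⋆ₐ[ℂ] (K →L[ℂ] K)) (hρ : Function.Injective ρ)
    (B : StarSubalgebra ℂ A) (hB : IsClosed (B : Set A))
    (E : A →ₗ[ℂ] A) (hE : IsConditionalExpectation B E) (hfin : HasFiniteIndex E) :
    ∃ EP : MinTensor π ρ →ₗ[ℂ] MinTensor π ρ,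
      (∀ a p, EP (tmul π ρ a p) = tmul π ρ (E a) p) ∧
      IsConditionalExpectation (sub π ρ B) EP ∧
      HasFiniteIndex EP ∧
      watataniIndex EP = tmul π ρ (watataniIndex E) 1 ∧
      (∀ C ∈ IMS B E, sub π ρ C ∈ IMS (sub π ρ B) EP) ∧
      (Nontrivial P → ∀ C ∈ IMS B E, ∀ D ∈ IMS B E,
        interiorAngle (sub π ρ B) EP (sub π ρ C) (sub π ρ D) = interiorAngle B E C D) := by
  obtain ⟨n, u, hu⟩ := id hfin
  refine ⟨(tensorId π ρ E).toLinearMap, tensorId_tmul ρ hπ hE hfin,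
    isConditionalExpectation_tensorId ρ hπ hE hfin, ⟨n, _, isQuasiBasis_tensorId ρ hπ hE hu⟩,
    watataniIndex_tensorId ρ hπ hE hfin, ?_, ?_⟩
  · rintro C ⟨F, hF⟩
    exact ⟨_, isCompatible_tensorId ρ hπ hE hfin hF⟩
  · intro _ C hC D hD
    exact interiorAngle_tensorId ρ hπ hρ hE hfin hC hD
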